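/- Let $n,d\ge 1$ and $0<\mu\le L$, $\tilde L\ge 0$. For $i\in[n]$ let $f_i:\mathbb R^d\to\mathbb R$ be twice continuously differentiable and such that for all $x,y\in\mathbb R^d$ $$\tfrac{\mu}{2}\|y-x\|^2\le f_i(y)-f_i(x)-\langle\nabla f_i(x),y-x\rangle\le\tfrac{L}{2}\|y-x\|^2,\qquad \|\nabla^2f_i(y)-\nabla^2f_i(x)\|\le\tilde L\|y-x\|$$ (Euclidean norm and spectral norm), and let $x^\star$ be the minimizer of $\frac1n\sum_{i=1}^n f_i$. Put $M=\tilde L\mu^{-3/2}$. Notation. For $d\times d$ matrices $B,K$ let $\sigma(B,K)=\mathrm{Tr}\big((K^{-1})^{\mathsf T}(B-K)\big)$, and for $u\in\mathbb R^d$ let $$\mathrm{BFGS}(B,K,u)=B-\frac{Buu^{\mathsf T}B}{\langle u,Bu\rangle}+\frac{Kuu^{\mathsf T}K}{\langle u,Ku\rangle},\qquad \mathrm{BFGS}(B,K,0)=B.$$ Let $\bar u(B,K)$ be any maximizer of $\langle u,Bu\rangle/\langle u,Ku\rangle$ over the standard basis vectors $u\in\{e_1,\dots,e_d\}$. The SLIQN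 method with correction factors $(\alpha_k)_{k\ge0}$, started from $x^0\in\mathbb R^d$ and matrices $I_i^0\succeq\nabla^2f_i(x^0)$ $(i\in[n])$, sets $z_i^0=x^0$, $D_i^0=(1+\alpha_0)^2I_i^0$, and for $t\ge1$, with $i_t=1+(t-1)\bmod n$ and with $\omega_t=(1+\alpha_{\lceil t/n\rceil})^2$ if $n\mid t$ and $\omega_t=1$ otherwise, $$x^t=\Big(\sum_{i=1}^nD_i^{t-1}\Big)^{-1}\sum_{i=1}^n\big(D_i^{t-1}z_i^{t-1}-\nabla f_i(z_i^{t-1})\big),\qquad z_{i_t}^t=x^t,$$ $$z_i^t=z_i^{t-1},\quad D_i^t=\omega_tD_i^{t-1}\quad(i\ne i_t),$$ $$Q^t=\mathrm{BFGS}\big(D_{i_t}^{t-1},(1+\alpha_{\lceil t/n-1\rceil})K^t,z_{i_t}^t-z_{i_t}^{t-1}\big),\quad K^t=\int_0^1\nabla^2f_{i_t}\big(z_{i_t}^{t-1}+\tau(z_{i_t}^t-z_{i_t}^{t-1})\big)\,d\tau,$$ $$D_{i_t}^t=\omega_t\,\mathrm{BFGS}\big(Q^t,\nabla^2f_{i_t}(z_{i_t}^t),\bar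 u(Q^t,\nabla^2f_{i_t}(z_{i_t}^t))\big).$$ Theorem. For every $\rho$ with $0<\rho<1-\frac{\mu}{dL}$ there exist $\varepsilon>0$ and $\sigma_0>0$ such that the following holds for the SLIQN method with correction factors $\alpha_k=M\sqrt L\,\varepsilon\rho^k$. If $\|x^0-x^\star\|\le\varepsilon$, $I_i^0\succeq\nabla^2f_i(x^0)$ and $\sigma(I_i^0,\nabla^2f_i(x^0))\le\sigma_0$ for all $i\in[n]$, then there is a sequence $(\zeta^k)_{k\ge0}$ with $$\|x^t-x^\star\|\le\zeta^{\lfloor (t-1)/n\rfloor}\quad\text{for all }t\ge1,\qquad \zeta^k\le\varepsilon\Big(1-\frac{\mu}{dL}\Big)^{\frac{(k+1)(k+2)}{2}}\quad\text{for all }k\ge0.$$ -/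

import Mathlib

noncomputable section

namespace SLIQN

open Matrix

/-- The space `ℝ^d` with its Euclidean norm. -/
abbrev Vec (d : ℕ) := EuclideanSpace ℝ (Fin d)

/-- Real `d × d` matrices. -/
abbrev Mat (d : ℕ) := Matrix (Fin d) (Fin d) ℝ

/-- The spectral norm of a matrix: its operator norm with respect to the Euclidean norm. -/
def specNorm {d : ℕ} (A : Mat d) : ℝ :=
  ‖(Matrix.toEuclideanCLM (n := Fin d) (𝕜 := ℝ) A)‖

/-- The Hessian matrix of `f` at `x`: column `j` is the derivative of the gradient of `f`
in the direction of the `j`-th basis vector. -/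
def hess {d : ℕ} (f : Vec d → ℝ) (x : Vec d) : Mat d :=
  Matrix.of fun i j => (fderiv ℝ (gradient f) x (EuclideanSpace.single j 1)) i

/-- `f` is `μ`-strongly convex (for differentiable `f`). -/
def StronglyConvex {d : ℕ} (μ : ℝ) (f : Vec d → ℝ) : Prop :=
  ∀ x y : Vec d, μ / 2 * ‖y - x‖ ^ 2 ≤ f y - f x - inner ℝ (gradient f x) (y - x)

/-- `f` is `L`-smooth (for differentiable `f`). -/
def Smooth {d : ℕ} (L : ℝ) (f : Vec d → ℝ) : Prop :=
  ∀ x y : Vec d, f y - f x - inner ℝ (gradient f x) (y - x) ≤ L / 2 * ‖y - x‖ ^ 2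

/-- The Hessian of `f` is Lipschitz with constant `Lt` in the spectral norm. -/
def LipschitzHessian {d : ℕ} (Lt : ℝ) (f : Vec d → ℝ) : Prop :=
  ∀ x y : Vec d, specNorm (hess f y - hess f x) ≤ Lt * ‖y - x‖

/-- The Hessian approximation error `σ(B, K) = ⟨K⁻¹, B - K⟩ = Tr((K⁻¹)ᵀ (B - K))`. -/
def sigma {d : ℕ} (B K : Mat d) : ℝ :=
  ((K⁻¹)ᵀ * (B - K)).trace

/-- The generalized BFGS update
`B - (B u uᵀ B) / ⟨u, B u⟩ + (K u uᵀ K) / ⟨u, K u⟩`.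
For `u = 0` both correction terms vanish, so the update leaves `B` unchanged. -/
def bfgs {d : ℕ} (B K : Mat d) (u : Fin d → ℝ) : Mat d :=
  B - (u ⬝ᵥ (B *ᵥ u))⁻¹ • (B * vecMulVec u u * B)
    + (u ⬝ᵥ (K *ᵥ u))⁻¹ • (K * vecMulVec u u * K)

/-- `u` is a greedy vector for `(B, K)`: it maximizes `⟨u, B u⟩ / ⟨u, K u⟩` among the
standard basis vectors (ties may be broken arbitrarily). -/
def IsGreedy {d : ℕ} (B K : Mat d) (u : Fin d → ℝ) : Prop :=
  (∃ k : Fin d, u = Pi.single k 1) ∧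
    ∀ v : Fin d → ℝ, (∃ j : Fin d, v = Pi.single j 1) →
      (v ⬝ᵥ (B *ᵥ v)) / (v ⬝ᵥ (K *ᵥ v)) ≤ (u ⬝ᵥ (B *ᵥ u)) / (u ⬝ᵥ (K *ᵥ u))

/-- The averaged Hessian `∫₀¹ ∇²f(z + τ (z' - z)) dτ`, entry by entry. -/
def avgHess {d : ℕ} (f : Vec d → ℝ) (z z' : Vec d) : Mat d :=
  Matrix.of fun i j => ∫ τ in (0 : ℝ)..1, hess f (z + τ • (z' - z)) i j

/-- The correction factors `α_k = M √L ε ρ^k`, where `M = Lt / μ^(3/2)`. -/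
def alpha (μ L Lt ε ρ : ℝ) (k : ℕ) : ℝ :=
  Lt / μ ^ (3 / 2 : ℝ) * √L * ε * ρ ^ k

/-- The scaling `ω_t`, equal to `(1 + α_⌈t/n⌉)²` if `n` divides `t` and to `1` otherwise. -/
def omega (n : ℕ) (α : ℕ → ℝ) (t : ℕ) : ℝ :=
  if t % n = 0 then (1 + α ⌈(t : ℝ) / n⌉₊) ^ 2 else 1

/-- The index `i_t` of the tuple updated in iteration `t ≥ 1`; with the indices `0, …, n - 1`
it is `(t - 1) mod n`. -/
def idx (n : ℕ) [NeZero n] (t : ℕ) : Fin n :=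
  ⟨(t - 1) % n, Nat.mod_lt _ (NeZero.pos n)⟩

/-- The sequences `x, z, D, Q, u` are a run of the sharpened lazy incremental quasi-Newton method
on `f_1, …, f_n` with correction factors `α`, initial point `x 0` and initial Hessian
approximations `I₀`.  The clauses other than the two about time `0` describe the iteration that
leads from time `t` to time `t + 1`. -/
structure IsRun {n d : ℕ} [NeZero n] (f : Fin n → Vec d → ℝ) (α : ℕ → ℝ) (I₀ : Fin n → Mat d)
    (x : ℕ → Vec d) (z : ℕ → Fin n → Vec d) (D : ℕ → Fin n → Mat d) (Q : ℕ → Mat d)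
    (u : ℕ → Fin d → ℝ) : Prop where
  z_zero : ∀ i, z 0 i = x 0
  D_zero : ∀ i, D 0 i = (1 + α 0) ^ 2 • I₀ i
  x_succ : ∀ t, x (t + 1) =
    Matrix.toEuclideanLin (∑ i, D t i)⁻¹
      (∑ i, (Matrix.toEuclideanLin (D t i) (z t i) - gradient (f i) (z t i)))
  z_succ : ∀ t, z (t + 1) (idx n (t + 1)) = x (t + 1)
  z_succ_of_ne : ∀ t i, i ≠ idx n (t + 1) → z (t + 1) i = z t i
  D_succ_of_ne : ∀ t i, i ≠ idx n (t + 1) → D (t + 1) i = omega n α (t + 1) • D t i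
  Q_succ : ∀ t, Q (t + 1) =
    bfgs (D t (idx n (t + 1)))
      ((1 + α ⌈((t + 1 : ℕ) : ℝ) / n - 1⌉₊) •
        avgHess (f (idx n (t + 1))) (z t (idx n (t + 1))) (z (t + 1) (idx n (t + 1))))
      (WithLp.ofLp (z (t + 1) (idx n (t + 1)) - z t (idx n (t + 1))))
  u_succ : ∀ t, IsGreedy (Q (t + 1))
    (hess (f (idx n (t + 1))) (z (t + 1) (idx n (t + 1)))) (u (t + 1))
  D_succ : ∀ t, D (t + 1) (idx n (t + 1)) = omega n α (t + 1) •
    bfgs (Q (t + 1)) (hess (f (idx n (t + 1))) (z (t + 1) (idx n (t + 1)))) (u (t + 1))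

end SLIQN

end

namespace SLIQN

open Matrix

/-! ### Loewner order, traces and quadratic forms. -/

section LinearAlgebra

variable {d : ℕ}

/-! Each tuple (z, D) is tracked by a scale s with D ⪰ s∇²f(z), an error e with Tr(∇²f(z)⁻¹D) ≤ s(d
+ e), and a bound r on the distance to x* (`Controlled`). A correction factor merely multiplies s.

Since the gradients at x* sum to zero, the Newton step is governed by the residuals D(z - x*) -
(∇f(z) - ∇f(x*)). Each is the matrix error D - ∇²f(z), of norm at most L(s(d + e) - d), applied to z
- x*, up to a quadratic Taylor remainder. So the distance shrinks by a factor of the order of matrix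
error plus distance (`norm_newton_step_sub_le`).

The Hessians at both ends of a step agree with the averaged Hessian up to a factor 1 + α_k in the
Loewner order. The corrections thus keep each matrix above its BFGS target, where the first update
does not increase the trace and the greedy one contracts the error by q = 1 - μ/(dL). The price is
(1 + α_k)⁴ on the trace (`Controlled.bfgs_update`).

Over an epoch the error obeys e_{k+1} ≤ q e_k + O(ερ^k), hence e_k = O(εq^k) because ρ < q. For
small ε the distance factor in epoch k is then at most ρq^k ≤ q^{k+1}, and these factors multiply to
the triangular exponent. Conversely, distances at most ερ^k are what makes α_k large enough; one
induction over single steps carries both bounds (`norm_sub_le_of_isRun`). -/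

theorem quadForm_le {A B : Mat d} (h : (B - A).PosSemidef) (v : Fin d → ℝ) :
    v ⬝ᵥ (A *ᵥ v) ≤ v ⬝ᵥ (B *ᵥ v) := by
  have := h.dotProduct_mulVec_nonneg v
  rw [sub_mulVec, dotProduct_sub] at this
  simpa using this

theorem posSemidef_sub_of_quadForm_le {A B : Mat d} (hA : A.IsHermitian) (hB : B.IsHermitian)
    (h : ∀ v : Fin d → ℝ, v ⬝ᵥ (A *ᵥ v) ≤ v ⬝ᵥ (B *ᵥ v)) : (B - A).PosSemidef := by
  refine .of_dotProduct_mulVec_nonneg (hB.sub hA) fun v => ?_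
  rw [sub_mulVec, dotProduct_sub]
  simpa using h v

theorem posSemidef_sub_trans {A B C : Mat d} (h₁ : (B - A).PosSemidef)
    (h₂ : (C - B).PosSemidef) : (C - A).PosSemidef := by
  simpa using h₂.add h₁

theorem bilinForm_comm {A : Mat d} (hA : A.IsHermitian) (v w : Fin d → ℝ) :
    v ⬝ᵥ (A *ᵥ w) = w ⬝ᵥ (A *ᵥ v) := by
  have hA' : Aᵀ = A := by simpa [IsHermitian, conjTranspose_eq_transpose_of_trivial] using hA
  rw [dotProduct_mulVec, ← mulVec_transpose, hA', dotProduct_comm]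

theorem quadForm_sub_smul {A : Mat d} (hA : A.IsHermitian) (v u : Fin d → ℝ) (s : ℝ) :
    (v - s • u) ⬝ᵥ (A *ᵥ (v - s • u)) =
      v ⬝ᵥ (A *ᵥ v) - 2 * s * (u ⬝ᵥ (A *ᵥ v)) + s ^ 2 * (u ⬝ᵥ (A *ᵥ u)) := by
  simp only [mulVec_sub, mulVec_smul, dotProduct_sub, sub_dotProduct, smul_dotProduct,
    dotProduct_smul, smul_eq_mul, bilinForm_comm hA v u]
  ring

/-- Cauchy–Schwarz: the form at w - s v is a nonnegative quadratic in s, so its discriminant is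
nonpositive. -/
theorem bilinForm_sq_le {A : Mat d} (hA : A.PosSemidef) (v w : Fin d → ℝ) :
    (v ⬝ᵥ (A *ᵥ w)) ^ 2 ≤ (v ⬝ᵥ (A *ᵥ v)) * (w ⬝ᵥ (A *ᵥ w)) := by
  have h : ∀ s : ℝ, 0 ≤ (v ⬝ᵥ (A *ᵥ v)) * (s * s) + (-2 * (v ⬝ᵥ (A *ᵥ w))) * s
      + w ⬝ᵥ (A *ᵥ w) := fun s => by
    have := hA.dotProduct_mulVec_nonneg (w - s • v)
    rw [star_trivial, quadForm_sub_smul hA.1] at this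
    linarith
  have := discrim_le_zero h
  rw [discrim] at this
  linarith

open scoped MatrixOrder in
theorem trace_mul_nonneg {A B : Mat d} (hA : A.PosSemidef) (hB : B.PosSemidef) :
    0 ≤ (A * B).trace := by
  obtain ⟨C, rfl⟩ := CStarAlgebra.nonneg_iff_eq_star_mul_self.1 hB.nonneg
  rw [star_eq_conjTranspose, ← Matrix.mul_assoc, trace_mul_comm, ← Matrix.mul_assoc]
  exact (hA.mul_mul_conjTranspose_same C).trace_nonneg

theorem trace_mul_le_trace_mul {P R A : Mat d} (h : (R - P).PosSemidef) (hA : A.PosSemidef) :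
    (P * A).trace ≤ (R * A).trace := by
  have := trace_mul_nonneg h hA
  rw [sub_mul, trace_sub] at this
  linarith

theorem posDef_of_posSemidef_sub {A B : Mat d} (hA : A.PosDef) (h : (B - A).PosSemidef) :
    B.PosDef := by
  simpa using hA.add_posSemidef h

/-- Inversion is antitone on positive definite matrices. -/
theorem inv_sub_inv_posSemidef {A B : Mat d} (hA : A.PosDef) (h : (B - A).PosSemidef) :
    (A⁻¹ - B⁻¹).PosSemidef := by
  have hB := posDef_of_posSemidef_sub hA h
  have hAu : IsUnit A.det := hA.det_pos.ne'.isUnit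
  have hBu : IsUnit B.det := hB.det_pos.ne'.isUnit
  refine posSemidef_sub_of_quadForm_le hB.inv.1 hA.inv.1 fun v => ?_
  have h₁ : B *ᵥ (B⁻¹ *ᵥ v) = v := by rw [mulVec_mulVec, mul_nonsing_inv _ hBu, one_mulVec]
  have h₂ : A *ᵥ (A⁻¹ *ᵥ v) = v := by rw [mulVec_mulVec, mul_nonsing_inv _ hAu, one_mulVec]
  have h₃ := quadForm_le h (B⁻¹ *ᵥ v)
  -- With p = B⁻¹v and q = A⁻¹v, this reads 0 ≤ ⟨p, Ap⟩ - 2⟨p, v⟩ + ⟨q, v⟩, while ⟨p, Ap⟩ ≤ ⟨p, Bp⟩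
  -- = ⟨p, v⟩.
  have h₄ := hA.posSemidef.dotProduct_mulVec_nonneg (B⁻¹ *ᵥ v - (1 : ℝ) • (A⁻¹ *ᵥ v))
  rw [star_trivial, quadForm_sub_smul hA.1, h₂] at h₄
  rw [h₁] at h₃
  rw [bilinForm_comm hA.1 (A⁻¹ *ᵥ v), h₂] at h₄
  rw [dotProduct_comm v, dotProduct_comm v]
  linarith

theorem inv_smul_matrix (K : Mat d) {a : ℝ} (ha : a ≠ 0) : (a • K)⁻¹ = a⁻¹ • K⁻¹ := by
  by_cases hK : IsUnit K.det
  · have : Invertible a := invertibleOfNonzero ha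
    rw [inv_smul K a hK, invOf_eq_inv]
  · rw [nonsing_inv_apply_not_isUnit _ hK, smul_zero, nonsing_inv_apply_not_isUnit]
    rw [det_smul, isUnit_iff_ne_zero, not_not] at *
    simp [hK]

/-- If `K ⪯ a H`, then `Tr (H⁻¹ A) ≤ a Tr (K⁻¹ A)` for `A ⪰ 0`. -/
theorem trace_inv_mul_le {H K A : Mat d} {a : ℝ} (ha : 0 < a) (hK : K.PosDef)
    (h : (a • H - K).PosSemidef) (hA : A.PosSemidef) :
    (H⁻¹ * A).trace ≤ a * (K⁻¹ * A).trace := by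
  have h₁ := trace_mul_le_trace_mul (inv_sub_inv_posSemidef hK h) hA
  rw [inv_smul_matrix H ha.ne', smul_mul_assoc, trace_smul, smul_eq_mul] at h₁
  calc (H⁻¹ * A).trace = a * (a⁻¹ * (H⁻¹ * A).trace) := by field_simp
    _ ≤ _ := by gcongr

/-- Pairs wwᵀ ⪯ ‖w‖² I with A under the trace. -/
theorem dotProduct_mulVec_le_trace {A : Mat d} (hA : A.PosSemidef) (w : Fin d → ℝ) :
    w ⬝ᵥ (A *ᵥ w) ≤ A.trace * (w ⬝ᵥ w) := by
  have h : ((w ⬝ᵥ w) • (1 : Mat d) - vecMulVec w w).PosSemidef := by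
    refine posSemidef_sub_of_quadForm_le (posSemidef_vecMulVec_self_star w).1
      ((isHermitian_one (n := Fin d) (α := ℝ)).smul (.all _)) fun v => ?_
    have := bilinForm_sq_le (PosSemidef.one (n := Fin d) (R := ℝ)) w v
    simp only [one_mulVec] at this
    simp only [vecMulVec_mulVec, smul_mulVec, one_mulVec, dotProduct_smul, smul_eq_mul,
      op_smul_eq_smul]
    rw [dotProduct_comm v w]
    linarith
  have := trace_mul_nonneg hA h
  rw [mul_sub, trace_sub, mul_smul_comm, trace_smul, mul_one, mul_vecMulVec, trace_vecMulVec,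
    smul_eq_mul, dotProduct_comm] at this
  rw [dotProduct_comm] at this ⊢
  linarith

/-- The trace bounds the spectral norm: Cauchy–Schwarz for the A-form at Av and v, with one factor
‖Av‖² cancelled. -/
theorem mulVec_dotProduct_self_le {A : Mat d} (hA : A.PosSemidef) (v : Fin d → ℝ) :
    (A *ᵥ v) ⬝ᵥ (A *ᵥ v) ≤ A.trace ^ 2 * (v ⬝ᵥ v) := by
  have h₁ := bilinForm_sq_le hA (A *ᵥ v) v
  have h₂ := dotProduct_mulVec_le_trace hA (A *ᵥ v)
  have h₃ := dotProduct_mulVec_le_trace hA v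
  have ht := hA.trace_nonneg
  have hn : 0 ≤ (A *ᵥ v) ⬝ᵥ (A *ᵥ v) := by
    simpa using dotProduct_star_self_nonneg (A *ᵥ v)
  have hv : 0 ≤ v ⬝ᵥ v := by simpa using dotProduct_star_self_nonneg v
  have h₄ : ((A *ᵥ v) ⬝ᵥ (A *ᵥ v)) ^ 2 ≤
      ((A *ᵥ v) ⬝ᵥ (A *ᵥ v)) * (A.trace ^ 2 * (v ⬝ᵥ v)) := by
    refine h₁.trans ((mul_le_mul h₂ h₃ (by simpa using hA.dotProduct_mulVec_nonneg v)
      (by positivity)).trans_eq (by ring))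
  rcases hn.eq_or_lt with h0 | h0
  · rw [← h0]; positivity
  · rw [sq] at h₄
    exact le_of_mul_le_mul_left h₄ h0

end LinearAlgebra

/-! ### The BFGS update: order preservation and trace decrease. -/

section BFGS

variable {d : ℕ} {B K : Mat d}

theorem mul_vecMulVec_mul (hB : B.IsHermitian) (u : Fin d → ℝ) :
    B * vecMulVec u u * B = vecMulVec (B *ᵥ u) (B *ᵥ u) := by
  have hB' : Bᵀ = B := by simpa [IsHermitian, conjTranspose_eq_transpose_of_trivial] using hB
  rw [mul_vecMulVec, vecMulVec_mul, ← mulVec_transpose, hB']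

theorem isHermitian_bfgs (hB : B.IsHermitian) (hK : K.IsHermitian) (u : Fin d → ℝ) :
    (bfgs B K u).IsHermitian := by
  rw [bfgs, mul_vecMulVec_mul hB, mul_vecMulVec_mul hK]
  exact (hB.sub ((posSemidef_vecMulVec_self_star (B *ᵥ u)).1.smul (.all _))).add
    ((posSemidef_vecMulVec_self_star (K *ᵥ u)).1.smul (.all _))

theorem quadForm_bfgs (hB : B.IsHermitian) (hK : K.IsHermitian) (u v : Fin d → ℝ) :
    v ⬝ᵥ (bfgs B K u *ᵥ v) = v ⬝ᵥ (B *ᵥ v) - (u ⬝ᵥ (B *ᵥ u))⁻¹ * (u ⬝ᵥ (B *ᵥ v)) ^ 2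
      + (u ⬝ᵥ (K *ᵥ u))⁻¹ * (u ⬝ᵥ (K *ᵥ v)) ^ 2 := by
  rw [bfgs, mul_vecMulVec_mul hB, mul_vecMulVec_mul hK]
  simp only [add_mulVec, sub_mulVec, smul_mulVec, vecMulVec_mulVec, dotProduct_add,
    dotProduct_sub, dotProduct_smul, smul_eq_mul, op_smul_eq_smul]
  rw [dotProduct_comm (B *ᵥ u) v, dotProduct_comm (K *ᵥ u) v, bilinForm_comm hB v u,
    bilinForm_comm hK v u]
  ring

theorem trace_mul_bfgs (hB : B.IsHermitian) (hK : K.IsHermitian) (P : Mat d)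
    (u : Fin d → ℝ) :
    (P * bfgs B K u).trace = (P * B).trace
      - (u ⬝ᵥ (B *ᵥ u))⁻¹ * ((B *ᵥ u) ⬝ᵥ (P *ᵥ (B *ᵥ u)))
      + (u ⬝ᵥ (K *ᵥ u))⁻¹ * ((K *ᵥ u) ⬝ᵥ (P *ᵥ (K *ᵥ u))) := by
  rw [bfgs, mul_vecMulVec_mul hB, mul_vecMulVec_mul hK]
  simp only [mul_add, mul_sub, mul_smul_comm, mul_vecMulVec, trace_add, trace_sub, trace_smul,
    trace_vecMulVec, smul_eq_mul]
  rw [dotProduct_comm (B *ᵥ u), dotProduct_comm (K *ᵥ u)]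

theorem bfgs_zero (B K : Mat d) : bfgs B K 0 = B := by
  simp [bfgs]

/-- The BFGS update of `B ⪰ K` still dominates `K`. -/
theorem bfgs_sub_posSemidef (hK : K.PosDef) (h : (B - K).PosSemidef) (u : Fin d → ℝ) :
    (bfgs B K u - K).PosSemidef := by
  have hB := posDef_of_posSemidef_sub hK h
  rcases eq_or_ne u 0 with rfl | hu
  · rwa [bfgs_zero]
  refine posSemidef_sub_of_quadForm_le hK.1 (isHermitian_bfgs hB.1 hK.1 u) fun v => ?_
  have hb : 0 < u ⬝ᵥ (B *ᵥ u) := by simpa using hB.dotProduct_mulVec_pos hu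
  have hk : 0 < u ⬝ᵥ (K *ᵥ u) := by simpa using hK.dotProduct_mulVec_pos hu
  -- This vector minimizes the B-form on the line v + ℝu; its value there is the B-part of the
  -- updated form. The rest is a square in the K-form.
  have h₁ := quadForm_le h (v - ((u ⬝ᵥ (B *ᵥ v)) / (u ⬝ᵥ (B *ᵥ u))) • u)
  rw [quadForm_sub_smul hB.1, quadForm_sub_smul hK.1] at h₁
  rw [quadForm_bfgs hB.1 hK.1]
  set b := u ⬝ᵥ (B *ᵥ u)
  set k := u ⬝ᵥ (K *ᵥ u)
  set x := u ⬝ᵥ (B *ᵥ v)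
  set y := u ⬝ᵥ (K *ᵥ v)
  have e₁ : v ⬝ᵥ (B *ᵥ v) - 2 * (x / b) * x + (x / b) ^ 2 * b
      = v ⬝ᵥ (B *ᵥ v) - b⁻¹ * x ^ 2 := by field_simp; ring
  have e₂ : 0 ≤ k * (x / b - y / k) ^ 2 := by positivity
  have e₃ : k * (x / b - y / k) ^ 2 = (x / b) ^ 2 * k - 2 * (x / b) * y + k⁻¹ * y ^ 2 := by
    field_simp
    ring
  linarith

/-- The decrease of `Tr (K⁻¹ B)` under a BFGS update. -/
theorem trace_inv_mul_bfgs_le (hK : K.PosDef) (h : (B - K).PosSemidef) {u : Fin d → ℝ}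
    (hu : u ≠ 0) :
    (K⁻¹ * bfgs B K u).trace ≤
      (K⁻¹ * B).trace - ((u ⬝ᵥ (B *ᵥ u)) / (u ⬝ᵥ (K *ᵥ u)) - 1) := by
  have hB := posDef_of_posSemidef_sub hK h
  have hKu : IsUnit K.det := hK.det_pos.ne'.isUnit
  have hb : 0 < u ⬝ᵥ (B *ᵥ u) := by simpa using hB.dotProduct_mulVec_pos hu
  have hk : 0 < u ⬝ᵥ (K *ᵥ u) := by simpa using hK.dotProduct_mulVec_pos hu
  have h₁ : K⁻¹ *ᵥ (K *ᵥ u) = u := by rw [mulVec_mulVec, nonsing_inv_mul _ hKu, one_mulVec]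
  -- Cauchy–Schwarz for K⁻¹ bounds the removed term below by ⟨u, Bu⟩/⟨u, Ku⟩; the added term
  -- contributes exactly 1.
  have h₂ := bilinForm_sq_le hK.inv.posSemidef (B *ᵥ u) (K *ᵥ u)
  rw [h₁, dotProduct_comm, dotProduct_comm (K *ᵥ u)] at h₂
  rw [trace_mul_bfgs hB.1 hK.1, h₁, dotProduct_comm (K *ᵥ u), inv_mul_cancel₀ hk.ne']
  set c := (B *ᵥ u) ⬝ᵥ (K⁻¹ *ᵥ (B *ᵥ u))
  have : u ⬝ᵥ (B *ᵥ u) / u ⬝ᵥ (K *ᵥ u) ≤ (u ⬝ᵥ (B *ᵥ u))⁻¹ * c := by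
    rw [div_le_iff₀ hk, inv_mul_eq_div, div_mul_eq_mul_div, le_div_iff₀ hb]
    linarith
  linarith

theorem trace_inv_mul_bfgs_le_self (hK : K.PosDef) (h : (B - K).PosSemidef)
    (u : Fin d → ℝ) : (K⁻¹ * bfgs B K u).trace ≤ (K⁻¹ * B).trace := by
  rcases eq_or_ne u 0 with rfl | hu
  · rw [bfgs_zero]
  have hk : 0 < u ⬝ᵥ (K *ᵥ u) := by simpa using hK.dotProduct_mulVec_pos hu
  have := (one_le_div hk).2 (quadForm_le h u)
  linarith [trace_inv_mul_bfgs_le hK h hu]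

theorem trace_inv_mul_sub (hK : K.PosDef) (B : Mat d) :
    (K⁻¹ * (B - K)).trace = (K⁻¹ * B).trace - d := by
  rw [mul_sub, trace_sub, nonsing_inv_mul _ hK.det_pos.ne'.isUnit, trace_one, Fintype.card_fin]

theorem trace_sub_le_of_le_smul_one {L : ℝ} (hL : 0 < L) (hK : K.PosDef)
    (hKL : (L • (1 : Mat d) - K).PosSemidef) (h : (B - K).PosSemidef) :
    (B - K).trace ≤ L * ((K⁻¹ * B).trace - d) := by
  have := trace_inv_mul_le hL hK hKL h
  rwa [inv_one, one_mul, trace_inv_mul_sub hK] at this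

theorem mul_trace_inv_mul_sub_le {μ : ℝ} (hμ : 0 < μ)
    (hKμ : (K - μ • (1 : Mat d)).PosSemidef) (h : (B - K).PosSemidef) :
    μ * ((K⁻¹ * B).trace - d) ≤ (B - K).trace := by
  have h1 : (μ • (1 : Mat d)).PosDef := PosDef.one.smul hμ
  have hK := posDef_of_posSemidef_sub h1 hKμ
  have := trace_mul_le_trace_mul (inv_sub_inv_posSemidef h1 hKμ) h
  rw [inv_smul_matrix _ hμ.ne', inv_one, smul_mul_assoc, one_mul, trace_smul, smul_eq_mul,
    trace_inv_mul_sub hK] at this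
  rwa [inv_mul_eq_div, le_div_iff₀ hμ, mul_comm] at this

/-- A greedy BFGS update contracts `Tr (K⁻¹ (B - K))` by the factor `1 - μ / (d L)`. -/
theorem trace_inv_mul_bfgs_greedy_le [NeZero d] {μ L : ℝ} (hμ : 0 < μ) (hL : 0 < L)
    (hKμ : (K - μ • (1 : Mat d)).PosSemidef) (hKL : (L • (1 : Mat d) - K).PosSemidef)
    (h : (B - K).PosSemidef) {u : Fin d → ℝ} (hu : IsGreedy B K u) :
    (K⁻¹ * bfgs B K u).trace - d ≤ (1 - μ / (d * L)) * ((K⁻¹ * B).trace - d) := by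
  have hK := posDef_of_posSemidef_sub (PosDef.one.smul hμ) hKμ
  have hd : (0 : ℝ) < d := by exact_mod_cast NeZero.pos d
  obtain ⟨⟨k, hk⟩, hmax⟩ := hu
  have hu0 : u ≠ 0 := by
    rintro rfl
    simpa using congrFun hk k
  have h₁ := trace_inv_mul_bfgs_le hK h hu0
  set r := u ⬝ᵥ (B *ᵥ u) / u ⬝ᵥ (K *ᵥ u)
  -- Greediness gives B_jj ≤ r K_jj for every j, so summing the diagonal bounds Tr(B - K) by dL(r -
  -- 1), where r - 1 is the guaranteed decrease.
  have hdiag : ∀ j, (B - K) j j ≤ (r - 1) * L := fun j => by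
    have h₂ := hmax _ ⟨j, rfl⟩
    simp only [single_one_dotProduct, mulVec_single_one, col_apply] at h₂
    have hKj : 0 < K j j := hK.diag_pos
    have hKjL : 0 ≤ (L • (1 : Mat d) - K) j j := hKL.diag_nonneg
    have hBj : 0 ≤ (B - K) j j := h.diag_nonneg
    simp only [Matrix.sub_apply, Matrix.smul_apply, one_apply_eq, smul_eq_mul, mul_one] at hKjL hBj ⊢
    rw [div_le_iff₀ hKj] at h₂
    have : 0 ≤ r - 1 := by
      by_contra! hlt
      nlinarith
    nlinarith
  have h₃ : (B - K).trace ≤ d * ((r - 1) * L) := by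
    rw [trace]
    refine (Finset.sum_le_sum fun j _ => hdiag j).trans_eq ?_
    simp
  have h₄ := mul_trace_inv_mul_sub_le hμ hKμ h
  have h₅ : μ / (d * L) * ((K⁻¹ * B).trace - d) ≤ r - 1 := by
    rw [div_mul_eq_mul_div, div_le_iff₀ (by positivity)]
    linarith
  linarith

end BFGS

/-! ### Hessians and averaged Hessians: bounds and Lipschitz comparisons. -/

section Calculus

variable {d : ℕ} {f : Vec d → ℝ} {μ L Lt : ℝ}

theorem toEuclideanCLM_hess (f : Vec d → ℝ) (x : Vec d) :
    toEuclideanCLM (n := Fin d) (𝕜 := ℝ) (hess f x) = fderiv ℝ (gradient f) x := by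
  apply ContinuousLinearMap.coe_injective
  refine (EuclideanSpace.basisFun (Fin d) ℝ).toBasis.ext fun j => ?_
  ext i
  simp [hess]

theorem dotProduct_hess_mulVec (f : Vec d → ℝ) (x : Vec d) (v w : Fin d → ℝ) :
    v ⬝ᵥ (hess f x *ᵥ w) =
      inner ℝ (WithLp.toLp 2 v) (fderiv ℝ (gradient f) x (WithLp.toLp 2 w)) := by
  rw [← toEuclideanCLM_hess, inner_toEuclideanCLM]

theorem dotProduct_self_eq_norm_sq (v : Fin d → ℝ) :
    v ⬝ᵥ v = ‖(WithLp.toLp 2 v : Vec d)‖ ^ 2 := by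
  rw [EuclideanSpace.real_norm_sq_eq, dotProduct]
  simp [sq]

theorem abs_dotProduct_mulVec_le_specNorm (A : Mat d) (v : Fin d → ℝ) :
    |v ⬝ᵥ (A *ᵥ v)| ≤ specNorm A * (v ⬝ᵥ v) := by
  have h : v ⬝ᵥ (A *ᵥ v) = inner ℝ (WithLp.toLp 2 v)
      (toEuclideanCLM (n := Fin d) (𝕜 := ℝ) A (WithLp.toLp 2 v)) := by
    rw [inner_toEuclideanCLM]
  rw [h, dotProduct_self_eq_norm_sq]
  refine (abs_real_inner_le_norm _ _).trans ?_
  calc _ ≤ ‖(WithLp.toLp 2 v : Vec d)‖ * (specNorm A * ‖(WithLp.toLp 2 v : Vec d)‖) := by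
        gcongr
        exact ContinuousLinearMap.le_opNorm _ _
    _ = _ := by ring

theorem contDiff_gradient (hf : ContDiff ℝ 2 f) : ContDiff ℝ 1 (gradient f) :=
  (InnerProductSpace.toDual ℝ (Vec d)).symm.contDiff.comp (hf.fderiv_right (by norm_num))

theorem inner_fderiv_gradient (hf : ContDiff ℝ 2 f) (x v w : Vec d) :
    inner ℝ (fderiv ℝ (gradient f) x v) w = fderiv ℝ (fderiv ℝ f) x v w := by
  have h₁ : HasFDerivAt (fderiv ℝ f) (fderiv ℝ (fderiv ℝ f) x) x :=
    ((hf.fderiv_right (m := 1) (by norm_num)).differentiable (by norm_num) x).hasFDerivAt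
  have h₂ : HasFDerivAt (gradient f) (fderiv ℝ (gradient f) x) x :=
    ((contDiff_gradient hf).differentiable (by norm_num) x).hasFDerivAt
  have h₃ := h₂.inner ℝ (hasFDerivAt_const w x)
  have h₄ := h₁.clm_apply (hasFDerivAt_const w x)
  have e : (fun y => inner ℝ (gradient f y) w) = fun y => fderiv ℝ f y w := by
    ext y
    rw [← toDual_gradient, InnerProductSpace.toDual_apply_apply]
  rw [e] at h₃
  have := congrArg (fun l => l v) (h₃.unique h₄)
  simpa using this

theorem isHermitian_hess (hf : ContDiff ℝ 2 f) (x : Vec d) : (hess f x).IsHermitian := by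
  have hsymm : IsSymmSndFDerivAt ℝ f x :=
    hf.contDiffAt.isSymmSndFDerivAt (by simp)
  have key : ∀ i j, hess f x i j = fderiv ℝ (fderiv ℝ f) x (EuclideanSpace.single j 1)
      (EuclideanSpace.single i 1) := fun i j => by
    rw [← inner_fderiv_gradient hf, EuclideanSpace.inner_single_right]
    simp [hess]
  ext i j
  rw [conjTranspose_apply, star_trivial, key, key]
  exact hsymm _ _

theorem inner_gradient_sub_ge (hconv : StronglyConvex μ f) (x y : Vec d) :
    μ * ‖y - x‖ ^ 2 ≤ inner ℝ (gradient f y - gradient f x) (y - x) := by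
  have h₁ := hconv x y
  have h₂ := hconv y x
  rw [norm_sub_rev, ← neg_sub y x, inner_neg_right] at h₂
  rw [inner_sub_left]
  linarith

theorem inner_gradient_sub_le (hsmooth : Smooth L f) (x y : Vec d) :
    inner ℝ (gradient f y - gradient f x) (y - x) ≤ L * ‖y - x‖ ^ 2 := by
  have h₁ := hsmooth x y
  have h₂ := hsmooth y x
  rw [norm_sub_rev, ← neg_sub y x, inner_neg_right] at h₂
  rw [inner_sub_left]
  linarith

/-- Transfers the two-point monotonicity bounds on the gradient to the Hessian form by passing to
the limit. -/
theorem tendsto_slope_gradient (hf : ContDiff ℝ 2 f) (x v : Vec d) :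
    Filter.Tendsto (fun t : ℝ => t⁻¹ ^ 2 * inner ℝ (gradient f (x + t • v) - gradient f x)
      ((x + t • v) - x)) (nhdsWithin 0 {0}ᶜ)
      (nhds (inner ℝ v (fderiv ℝ (gradient f) x v))) := by
  have h₀ : HasFDerivAt (gradient f) (fderiv ℝ (gradient f) x) (x + (0 : ℝ) • v) := by
    rw [zero_smul, add_zero]
    exact ((contDiff_gradient hf).differentiable (by norm_num) x).hasFDerivAt
  have h₁ : HasDerivAt (fun t : ℝ => x + t • v) v 0 := by
    simpa using ((hasDerivAt_id (0 : ℝ)).smul_const v).const_add x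
  have h₂ := (h₀.comp_hasDerivAt (0 : ℝ) h₁).tendsto_slope
  have h₃ := (tendsto_const_nhds (x := v)).inner (𝕜 := ℝ) h₂
  refine h₃.congr' ?_
  filter_upwards [self_mem_nhdsWithin] with t ht
  have ht' : t ≠ 0 := ht
  simp only [slope, Function.comp_apply, zero_smul, add_zero, sub_zero, vsub_eq_sub,
    inner_smul_right, add_sub_cancel_left]
  rw [real_inner_comm]
  field_simp

theorem inner_fderiv_gradient_ge (hf : ContDiff ℝ 2 f) (hconv : StronglyConvex μ f)
    (x v : Vec d) : μ * ‖v‖ ^ 2 ≤ inner ℝ v (fderiv ℝ (gradient f) x v) := by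
  refine ge_of_tendsto (tendsto_slope_gradient hf x v) ?_
  filter_upwards [self_mem_nhdsWithin] with t ht
  have ht' : t ≠ 0 := ht
  calc μ * ‖v‖ ^ 2 = t⁻¹ ^ 2 * (μ * ‖(x + t • v) - x‖ ^ 2) := by
        rw [add_sub_cancel_left, norm_smul, mul_pow, Real.norm_eq_abs, sq_abs]
        field_simp
    _ ≤ _ := by
        gcongr
        exact inner_gradient_sub_ge hconv _ _

theorem inner_fderiv_gradient_le (hf : ContDiff ℝ 2 f) (hsmooth : Smooth L f)
    (x v : Vec d) : inner ℝ v (fderiv ℝ (gradient f) x v) ≤ L * ‖v‖ ^ 2 := by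
  refine le_of_tendsto (tendsto_slope_gradient hf x v) ?_
  filter_upwards [self_mem_nhdsWithin] with t ht
  have ht' : t ≠ 0 := ht
  calc _ ≤ t⁻¹ ^ 2 * (L * ‖(x + t • v) - x‖ ^ 2) := by
        gcongr
        exact inner_gradient_sub_le hsmooth _ _
    _ = L * ‖v‖ ^ 2 := by
        rw [add_sub_cancel_left, norm_smul, mul_pow, Real.norm_eq_abs, sq_abs]
        field_simp

theorem isHermitian_smul_one (c : ℝ) : (c • (1 : Mat d)).IsHermitian :=
  isHermitian_one.smul (.all _)

theorem quadForm_smul_one (c : ℝ) (v : Fin d → ℝ) :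
    v ⬝ᵥ ((c • (1 : Mat d)) *ᵥ v) = c * (v ⬝ᵥ v) := by
  simp [smul_mulVec]

theorem hess_sub_smul_one_posSemidef (hf : ContDiff ℝ 2 f) (hconv : StronglyConvex μ f)
    (x : Vec d) : (hess f x - μ • (1 : Mat d)).PosSemidef := by
  refine posSemidef_sub_of_quadForm_le (isHermitian_smul_one μ) (isHermitian_hess hf x)
    fun v => ?_
  rw [quadForm_smul_one, dotProduct_hess_mulVec, dotProduct_self_eq_norm_sq]
  exact inner_fderiv_gradient_ge hf hconv x _

theorem smul_one_sub_hess_posSemidef (hf : ContDiff ℝ 2 f) (hsmooth : Smooth L f)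
    (x : Vec d) : (L • (1 : Mat d) - hess f x).PosSemidef := by
  refine posSemidef_sub_of_quadForm_le (isHermitian_hess hf x) (isHermitian_smul_one L)
    fun v => ?_
  rw [quadForm_smul_one, dotProduct_hess_mulVec, dotProduct_self_eq_norm_sq]
  exact inner_fderiv_gradient_le hf hsmooth x _

theorem continuous_hess_apply (hf : ContDiff ℝ 2 f) (i j : Fin d) :
    Continuous fun x => hess f x i j := by
  have h : Continuous fun x => fderiv ℝ (gradient f) x (EuclideanSpace.single j 1) :=
    ((contDiff_gradient hf).continuous_fderiv (by norm_num)).clm_apply continuous_const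
  exact (EuclideanSpace.proj (𝕜 := ℝ) i).continuous.comp h

theorem continuous_hess_line_apply (hf : ContDiff ℝ 2 f) (z z' : Vec d) (i j : Fin d) :
    Continuous fun τ : ℝ => hess f (z + τ • (z' - z)) i j :=
  (continuous_hess_apply hf i j).comp (by fun_prop)

theorem continuous_quadForm_hess_line (hf : ContDiff ℝ 2 f) (z z' : Vec d) (v : Fin d → ℝ) :
    Continuous fun τ : ℝ => v ⬝ᵥ (hess f (z + τ • (z' - z)) *ᵥ v) := by
  simp only [dotProduct, mulVec]
  exact continuous_finsetSum _ fun i _ => continuous_const.mul <|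
    continuous_finsetSum _ fun j _ => (continuous_hess_line_apply hf z z' i j).mul continuous_const

theorem quadForm_avgHess (hf : ContDiff ℝ 2 f) (z z' : Vec d) (v : Fin d → ℝ) :
    v ⬝ᵥ (avgHess f z z' *ᵥ v) =
      ∫ τ in (0 : ℝ)..1, v ⬝ᵥ (hess f (z + τ • (z' - z)) *ᵥ v) := by
  simp only [dotProduct, mulVec, avgHess, of_apply]
  rw [intervalIntegral.integral_finsetSum]
  · refine Finset.sum_congr rfl fun i _ => ?_
    rw [intervalIntegral.integral_const_mul, intervalIntegral.integral_finsetSum]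
    · simp only [intervalIntegral.integral_mul_const]
    · exact fun j _ => ((continuous_hess_line_apply hf z z' i j).mul
        continuous_const).intervalIntegrable _ _
  · exact fun i _ => (continuous_const.mul <| continuous_finsetSum _ fun j _ =>
      (continuous_hess_line_apply hf z z' i j).mul continuous_const).intervalIntegrable _ _

theorem isHermitian_avgHess (hf : ContDiff ℝ 2 f) (z z' : Vec d) :
    (avgHess f z z').IsHermitian := by
  ext i j
  simp only [conjTranspose_apply, star_trivial, avgHess, of_apply]
  congr 1
  ext τ
  simpa using (isHermitian_hess hf (z + τ • (z' - z))).apply i j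

theorem avgHess_sub_smul_one_posSemidef (hf : ContDiff ℝ 2 f) (hconv : StronglyConvex μ f)
    (z z' : Vec d) : (avgHess f z z' - μ • (1 : Mat d)).PosSemidef := by
  refine posSemidef_sub_of_quadForm_le (isHermitian_smul_one μ) (isHermitian_avgHess hf z z')
    fun v => ?_
  have h := intervalIntegral.integral_mono_on (μ := MeasureTheory.volume) (a := (0 : ℝ)) (b := 1)
    (f := fun _ => v ⬝ᵥ ((μ • (1 : Mat d)) *ᵥ v)) zero_le_one
    (continuous_const.intervalIntegrable _ _)
    ((continuous_quadForm_hess_line hf z z' v).intervalIntegrable _ _)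
    fun τ _ => quadForm_le (hess_sub_smul_one_posSemidef hf hconv _) v
  rw [quadForm_avgHess hf]
  simpa using h

/-- Serves both endpoints: g τ is the fraction of the segment between the integration point and y,
namely τ or 1 - τ, and its mean 1/2 halves the Lipschitz bound. -/
theorem abs_quadForm_avgHess_sub_le (hf : ContDiff ℝ 2 f) (hLip : LipschitzHessian Lt f)
    (z z' y : Vec d) {g : ℝ → ℝ} (hg : Continuous g) (hg' : ∫ τ in (0 : ℝ)..1, g τ = 1 / 2)
    (hy : ∀ τ ∈ Set.Icc (0 : ℝ) 1, z + τ • (z' - z) - y = g τ • (z' - z) ∨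
      z + τ • (z' - z) - y = -(g τ • (z' - z)))
    (hg0 : ∀ τ ∈ Set.Icc (0 : ℝ) 1, 0 ≤ g τ) (v : Fin d → ℝ) :
    |v ⬝ᵥ (avgHess f z z' *ᵥ v) - v ⬝ᵥ (hess f y *ᵥ v)| ≤
      Lt * ‖z' - z‖ / 2 * (v ⬝ᵥ v) := by
  have hcont := continuous_quadForm_hess_line hf z z' v
  have e : v ⬝ᵥ (avgHess f z z' *ᵥ v) - v ⬝ᵥ (hess f y *ᵥ v) =
      ∫ τ in (0 : ℝ)..1, (v ⬝ᵥ (hess f (z + τ • (z' - z)) *ᵥ v) - v ⬝ᵥ (hess f y *ᵥ v)) := by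
    rw [quadForm_avgHess hf, intervalIntegral.integral_sub (hcont.intervalIntegrable _ _)
      (continuous_const.intervalIntegrable _ _)]
    simp
  rw [e]
  refine (intervalIntegral.abs_integral_le_integral_abs zero_le_one).trans ?_
  calc _ ≤ ∫ τ in (0 : ℝ)..1, g τ * (Lt * ‖z' - z‖ * (v ⬝ᵥ v)) := by
        refine intervalIntegral.integral_mono_on zero_le_one
          ((hcont.sub continuous_const).abs.intervalIntegrable _ _)
          ((hg.mul continuous_const).intervalIntegrable _ _) fun τ hτ => ?_
        rw [← dotProduct_sub, ← sub_mulVec]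
        refine (abs_dotProduct_mulVec_le_specNorm _ v).trans ?_
        have hn : ‖z + τ • (z' - z) - y‖ = g τ * ‖z' - z‖ := by
          rcases hy τ hτ with h | h <;>
            simp only [h, norm_neg, norm_smul, Real.norm_eq_abs, abs_of_nonneg (hg0 τ hτ)]
        have hv : 0 ≤ v ⬝ᵥ v := by rw [dotProduct_self_eq_norm_sq]; positivity
        calc _ ≤ Lt * ‖z + τ • (z' - z) - y‖ * (v ⬝ᵥ v) := by
              gcongr
              exact hLip _ _
          _ = _ := by rw [hn]; ring
    _ = _ := by rw [intervalIntegral.integral_mul_const, hg']; ring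

theorem abs_quadForm_avgHess_sub_left_le (hf : ContDiff ℝ 2 f) (hLip : LipschitzHessian Lt f)
    (z z' : Vec d) (v : Fin d → ℝ) :
    |v ⬝ᵥ (avgHess f z z' *ᵥ v) - v ⬝ᵥ (hess f z *ᵥ v)| ≤ Lt * ‖z' - z‖ / 2 * (v ⬝ᵥ v) := by
  refine abs_quadForm_avgHess_sub_le hf hLip z z' z (g := fun τ => τ) continuous_id ?_
    (fun τ _ => .inl (by simp)) (fun τ hτ => hτ.1) v
  rw [integral_id]; norm_num

theorem abs_quadForm_avgHess_sub_right_le (hf : ContDiff ℝ 2 f) (hLip : LipschitzHessian Lt f)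
    (z z' : Vec d) (v : Fin d → ℝ) :
    |v ⬝ᵥ (avgHess f z z' *ᵥ v) - v ⬝ᵥ (hess f z' *ᵥ v)| ≤ Lt * ‖z' - z‖ / 2 * (v ⬝ᵥ v) := by
  refine abs_quadForm_avgHess_sub_le hf hLip z z' z' (g := fun τ => 1 - τ) (by fun_prop) ?_
    (fun τ _ => .inr (by module)) (fun τ hτ => sub_nonneg.2 hτ.2) v
  rw [intervalIntegral.integral_sub (by simp) (by simp), integral_id]; norm_num

/-- An additive error c‖v‖² is a relative error c/μ, because ‖v‖² ≤ μ⁻¹⟨v, Bv⟩. -/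
theorem smul_sub_posSemidef_of_abs_quadForm_le {A B : Mat d} {a c : ℝ} (hμ : 0 < μ)
    (hA : A.IsHermitian) (hB : B.IsHermitian) (hBμ : (B - μ • (1 : Mat d)).PosSemidef)
    (h : ∀ v : Fin d → ℝ, |v ⬝ᵥ (A *ᵥ v) - v ⬝ᵥ (B *ᵥ v)| ≤ c * (v ⬝ᵥ v))
    (hc : 0 ≤ c) (ha : 1 + c / μ ≤ a) : (a • B - A).PosSemidef := by
  refine posSemidef_sub_of_quadForm_le hA (hB.smul (.all _)) fun v => ?_
  have h₁ := quadForm_le hBμ v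
  have h₂ := (abs_le.1 (h v)).2
  have hv : 0 ≤ v ⬝ᵥ v := by rw [dotProduct_self_eq_norm_sq]; positivity
  rw [quadForm_smul_one] at h₁
  rw [smul_mulVec, dotProduct_smul, smul_eq_mul]
  have h₃ : c * (v ⬝ᵥ v) ≤ c / μ * (v ⬝ᵥ (B *ᵥ v)) := by
    calc c * (v ⬝ᵥ v) = c / μ * (μ * (v ⬝ᵥ v)) := by field_simp
      _ ≤ _ := by gcongr
  have h₄ : (1 + c / μ) * (v ⬝ᵥ (B *ᵥ v)) ≤ a * (v ⬝ᵥ (B *ᵥ v)) := by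
    have : 0 ≤ v ⬝ᵥ (B *ᵥ v) := h₁.trans' (by positivity)
    gcongr
  linarith

/-- Mean value inequality on the ball about z through y. The constant is not the sharp Lt/2, but the
choice of ε absorbs the difference. -/
theorem norm_gradient_sub_sub_le (hf : ContDiff ℝ 2 f) (hLt : 0 ≤ Lt)
    (hLip : LipschitzHessian Lt f) (z y : Vec d) :
    ‖gradient f z - gradient f y - fderiv ℝ (gradient f) z (z - y)‖ ≤ Lt * ‖z - y‖ ^ 2 := by
  have h := (convex_closedBall z ‖z - y‖).norm_image_sub_le_of_norm_fderiv_le'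
    (f := gradient f) (φ := fderiv ℝ (gradient f) z) (𝕜 := ℝ) (C := Lt * ‖z - y‖)
    (fun x _ => (contDiff_gradient hf).differentiable (by norm_num) x)
    (fun x hx => ?_) (x := y) (y := z) ?_ ?_
  · linarith
  · rw [← toEuclideanCLM_hess, ← toEuclideanCLM_hess, ← map_sub]
    refine (hLip z x).trans ?_
    gcongr
    simpa [dist_eq_norm] using hx
  · simp [dist_eq_norm, norm_sub_rev]
  · simp

theorem sum_gradient_eq_zero {n : ℕ} [NeZero n] {f : Fin n → Vec d → ℝ}
    (hf : ∀ i, ContDiff ℝ 2 (f i)) {xstar : Vec d}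
    (hmin : ∀ y, (1 / (n : ℝ)) * ∑ i, f i xstar ≤ (1 / (n : ℝ)) * ∑ i, f i y) :
    ∑ i, gradient (f i) xstar = 0 := by
  have hn : (0 : ℝ) < 1 / n := by
    have : (0 : ℝ) < n := by exact_mod_cast NeZero.pos n
    positivity
  have hloc : IsLocalMin (fun y => ∑ i, f i y) xstar :=
    Filter.Eventually.of_forall fun y => le_of_mul_le_mul_left (hmin y) hn
  have h := hloc.fderiv_eq_zero
  rw [fderiv_fun_sum fun i _ => (hf i).differentiable (by norm_num) xstar] at h
  apply (InnerProductSpace.toDual ℝ (Vec d)).injective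
  rw [map_sum, map_zero, ← h]
  exact Finset.sum_congr rfl fun i _ => toDual_gradient

theorem modulus_le_of_stronglyConvex_of_smooth [NeZero d] (hconv : StronglyConvex μ f)
    (hsmooth : Smooth L f) : μ ≤ L := by
  have h := (hconv 0 (EuclideanSpace.single 0 1)).trans (hsmooth 0 (EuclideanSpace.single 0 1))
  simp at h
  linarith

theorem lipschitzHessian_const_nonneg [NeZero d] (hLip : LipschitzHessian Lt f) : 0 ≤ Lt := by
  have h := (norm_nonneg _).trans (hLip 0 (EuclideanSpace.single 0 1))
  simpa using h

end Calculus

/-! ### One Newton step, one matrix update, and the induction over epochs. -/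

section Run

variable {n d : ℕ} {μ L Lt : ℝ}

/-- `D` dominates `s ∇²f(z)`, exceeds it in the trace weighted by `∇²f(z)⁻¹` by at most `s e`,
and `z` has distance at most `r` from `xstar`. -/
structure Controlled (f : Vec d → ℝ) (xstar : Vec d) (s e r : ℝ) (z : Vec d) (D : Mat d) :
    Prop where
  posSemidef : (D - s • hess f z).PosSemidef
  trace_le : ((hess f z)⁻¹ * D).trace ≤ s * (d + e)
  dist_le : ‖z - xstar‖ ≤ r

theorem Controlled.smul {f : Vec d → ℝ} {xstar z : Vec d} {s e r w : ℝ} {D : Mat d}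
    (h : Controlled f xstar s e r z D) (hw : 0 ≤ w) :
    Controlled f xstar (w * s) e r z (w • D) where
  posSemidef := by
    rw [mul_smul, ← smul_sub]
    exact h.posSemidef.smul hw
  trace_le := by
    rw [mul_smul_comm, trace_smul, smul_eq_mul, mul_assoc]
    exact mul_le_mul_of_nonneg_left h.trace_le hw
  dist_le := h.dist_le

theorem hess_posDef {f : Vec d → ℝ} (hμ : 0 < μ) (hf : ContDiff ℝ 2 f)
    (hconv : StronglyConvex μ f) (x : Vec d) : (hess f x).PosDef :=
  posDef_of_posSemidef_sub (PosDef.one.smul hμ) (hess_sub_smul_one_posSemidef hf hconv x)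

theorem sub_posSemidef_of_one_le {H D : Mat d} {s : ℝ} (hs : 1 ≤ s) (hH : H.PosSemidef)
    (h : (D - s • H).PosSemidef) : (D - H).PosSemidef := by
  have := h.add (hH.smul (sub_nonneg.2 hs))
  rwa [sub_smul, one_smul, sub_add_sub_cancel] at this

theorem norm_toEuclideanLin_le_trace {A : Mat d} (hA : A.PosSemidef) (v : Vec d) :
    ‖toEuclideanLin A v‖ ≤ A.trace * ‖v‖ := by
  refine le_of_sq_le_sq ?_ (mul_nonneg hA.trace_nonneg (norm_nonneg _))
  have h := mulVec_dotProduct_self_le hA (WithLp.ofLp v)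
  rw [dotProduct_self_eq_norm_sq, dotProduct_self_eq_norm_sq] at h
  rw [mul_pow]
  exact h

theorem toEuclideanLin_hess (f : Vec d → ℝ) (x v : Vec d) :
    toEuclideanLin (hess f x) v = fderiv ℝ (gradient f) x v := by
  rw [← toEuclideanCLM_hess]
  rfl

theorem Controlled.norm_residual_le {f : Vec d → ℝ} {xstar z : Vec d} {s e r : ℝ} {D : Mat d}
    (hμ : 0 < μ) (hL : 0 < L) (hLt : 0 ≤ Lt) (hf : ContDiff ℝ 2 f)
    (hconv : StronglyConvex μ f) (hsmooth : Smooth L f) (hLip : LipschitzHessian Lt f)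
    (h : Controlled f xstar s e r z D) (hs : 1 ≤ s) :
    ‖toEuclideanLin D (z - xstar) - (gradient f z - gradient f xstar)‖ ≤
      (L * (s * (d + e) - d) + Lt * r) * r := by
  have hH := hess_posDef hμ hf hconv z
  have hD := sub_posSemidef_of_one_le hs hH.posSemidef h.posSemidef
  have h₁ := norm_toEuclideanLin_le_trace hD (z - xstar)
  have h₂ := norm_gradient_sub_sub_le hf hLt hLip z xstar
  have h₃ := trace_sub_le_of_le_smul_one hL hH (smul_one_sub_hess_posSemidef hf hsmooth z) hD
  -- Matrix error applied to z - x*, minus the Taylor remainder of the gradient.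
  have e₁ : toEuclideanLin D (z - xstar) - (gradient f z - gradient f xstar) =
      toEuclideanLin (D - hess f z) (z - xstar) -
        (gradient f z - gradient f xstar - fderiv ℝ (gradient f) z (z - xstar)) := by
    rw [map_sub toEuclideanLin, LinearMap.sub_apply, toEuclideanLin_hess]
    abel
  have ht := hD.trace_nonneg
  have hr : 0 ≤ r := (norm_nonneg _).trans h.dist_le
  have h₄ : (D - hess f z).trace ≤ L * (s * (d + e) - d) :=
    h₃.trans (by gcongr; exact h.trace_le)
  rw [e₁]
  calc _ ≤ (D - hess f z).trace * ‖z - xstar‖ + Lt * ‖z - xstar‖ ^ 2 :=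
        (norm_sub_le _ _).trans (add_le_add h₁ h₂)
    _ ≤ L * (s * (d + e) - d) * r + Lt * r ^ 2 := by
        have := h.dist_le
        gcongr
        exact ht.trans h₄
    _ = _ := by ring

theorem norm_le_of_smul_one_le {S : Mat d} {c : ℝ}
    (hS : (S - c • (1 : Mat d)).PosSemidef) (w : Vec d) : c * ‖w‖ ≤ ‖toEuclideanLin S w‖ := by
  have h := quadForm_le hS (WithLp.ofLp w)
  rw [quadForm_smul_one, dotProduct_self_eq_norm_sq] at h
  have h' : WithLp.ofLp w ⬝ᵥ (S *ᵥ WithLp.ofLp w) = inner ℝ w (toEuclideanLin S w) :=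
    (inner_toEuclideanCLM S w w).symm
  rw [h'] at h
  have h₂ := h.trans (real_inner_le_norm _ _)
  rcases (norm_nonneg w).eq_or_lt with h0 | h0
  · rw [← h0]; simp
  · refine le_of_mul_le_mul_left ?_ h0
    simp only [WithLp.toLp_ofLp] at h₂
    linarith

/-- One step of the incremental quasi-Newton iteration. -/
theorem norm_newton_step_sub_le [NeZero n] {f : Fin n → Vec d → ℝ} {xstar : Vec d}
    {z : Fin n → Vec d} {D : Fin n → Mat d} {s : Fin n → ℝ} {e r : Fin n → ℝ} {c : ℝ}
    (hμ : 0 < μ) (hL : 0 < L) (hLt : 0 ≤ Lt) (hf : ∀ i, ContDiff ℝ 2 (f i))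
    (hconv : ∀ i, StronglyConvex μ (f i)) (hsmooth : ∀ i, Smooth L (f i))
    (hLip : ∀ i, LipschitzHessian Lt (f i)) (hgrad : ∑ i, gradient (f i) xstar = 0)
    (h : ∀ i, Controlled (f i) xstar (s i) (e i) (r i) (z i) (D i)) (hs : ∀ i, 1 ≤ s i)
    (hc : ∀ i, (L * (s i * (d + e i) - d) + Lt * r i) * r i ≤ c) :
    μ * ‖toEuclideanLin (∑ i, D i)⁻¹
      (∑ i, (toEuclideanLin (D i) (z i) - gradient (f i) (z i))) - xstar‖ ≤ c := by
  have hn : (0 : ℝ) < n := by exact_mod_cast NeZero.pos n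
  have hS : (∑ i, D i - (n * μ) • (1 : Mat d)).PosSemidef := by
    have e₁ : ∑ i, D i - (n * μ) • (1 : Mat d) = ∑ i, (D i - μ • (1 : Mat d)) := by
      rw [Finset.sum_sub_distrib, Finset.sum_const, Finset.card_univ, Fintype.card_fin,
        mul_smul, Nat.cast_smul_eq_nsmul]
    rw [e₁]
    exact posSemidef_sum _ fun i _ => posSemidef_sub_trans
      (hess_sub_smul_one_posSemidef (hf i) (hconv i) (z i))
      (sub_posSemidef_of_one_le (hs i) (hess_posDef hμ (hf i) (hconv i) _).posSemidef
        (h i).posSemidef)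
  have hSd : IsUnit (∑ i, D i).det :=
    (posDef_of_posSemidef_sub (PosDef.one.smul (mul_pos hn hμ)) hS).det_pos.ne'.isUnit
  set g := ∑ i, (toEuclideanLin (D i) (z i) - gradient (f i) (z i)) with hg
  have h₁ := norm_le_of_smul_one_le hS (toEuclideanLin (∑ i, D i)⁻¹ g - xstar)
  have h₂ : toEuclideanLin (∑ i, D i) (toEuclideanLin (∑ i, D i)⁻¹ g - xstar) =
      ∑ i, (toEuclideanLin (D i) (z i - xstar) -
        (gradient (f i) (z i) - gradient (f i) xstar)) := by
    have h₃ : toEuclideanLin (∑ i, D i) (toEuclideanLin (∑ i, D i)⁻¹ g) = g := by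
      simp only [toLpLin_apply, mulVec_mulVec, mul_nonsing_inv _ hSd, one_mulVec, WithLp.toLp_ofLp]
    rw [map_sub, h₃, hg, map_sum, LinearMap.sum_apply]
    simp only [map_sub, Finset.sum_sub_distrib, hgrad]
    abel
  rw [h₂] at h₁
  have h₄ : n * (μ * ‖toEuclideanLin (∑ i, D i)⁻¹ g - xstar‖) ≤ n * c := by
    rw [← mul_assoc]
    refine h₁.trans ((norm_sum_le _ _).trans ?_)
    refine (Finset.sum_le_sum fun i _ => ((h i).norm_residual_le hμ hL hLt (hf i) (hconv i)
      (hsmooth i) (hLip i) (hs i)).trans (hc i)).trans_eq ?_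
    simp
  exact le_of_mul_le_mul_left h₄ hn

/-- The two BFGS updates preserve the control of the Hessian approximation. -/
theorem Controlled.bfgs_update [NeZero d] {f : Vec d → ℝ} {xstar z z' : Vec d}
    {a e r r' : ℝ} {D : Mat d} {v u : Fin d → ℝ}
    (hμ : 0 < μ) (hL : 0 < L) (hLt : 0 ≤ Lt) (hμL : μ ≤ L) (hf : ContDiff ℝ 2 f)
    (hconv : StronglyConvex μ f) (hsmooth : Smooth L f) (hLip : LipschitzHessian Lt f)
    (h : Controlled f xstar (a ^ 2) e r z D) (hz' : ‖z' - xstar‖ ≤ r')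
    (ha : 1 + Lt * ‖z' - z‖ / 2 / μ ≤ a)
    (hu : IsGreedy (bfgs D (a • avgHess f z z') v) (hess f z') u) :
    Controlled f xstar 1 ((1 - μ / (d * L)) * (a ^ 4 * (d + e) - d)) r' z'
      (bfgs (bfgs D (a • avgHess f z z') v) (hess f z') u) := by
  have hc : 0 ≤ Lt * ‖z' - z‖ / 2 := by positivity
  have ha1 : 1 ≤ a := le_trans (by linarith [div_nonneg hc hμ.le]) ha
  have ha0 : 0 < a := by linarith
  set K := avgHess f z z' with hK
  set H := hess f z with hH
  set H' := hess f z' with hH'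
  have sK : K.IsHermitian := isHermitian_avgHess hf z z'
  have sH : H.IsHermitian := isHermitian_hess hf z
  have sH' : H'.IsHermitian := isHermitian_hess hf z'
  have μK := avgHess_sub_smul_one_posSemidef hf hconv z z'
  have μH := hess_sub_smul_one_posSemidef hf hconv z
  have μH' := hess_sub_smul_one_posSemidef hf hconv z'
  have pK : K.PosDef := posDef_of_posSemidef_sub (PosDef.one.smul hμ) μK
  have pH : H.PosDef := hess_posDef hμ hf hconv z
  have pH' : H'.PosDef := hess_posDef hμ hf hconv z'
  -- K is within a factor a of both H and H', in both directions.
  have KH : (a • H - K).PosSemidef := smul_sub_posSemidef_of_abs_quadForm_le hμ sK sH μH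
    (abs_quadForm_avgHess_sub_left_le hf hLip z z') hc ha
  have KH' : (a • H' - K).PosSemidef := smul_sub_posSemidef_of_abs_quadForm_le hμ sK sH' μH'
    (abs_quadForm_avgHess_sub_right_le hf hLip z z') hc ha
  have HK : (a • K - H).PosSemidef := smul_sub_posSemidef_of_abs_quadForm_le hμ sH sK μK
    (fun w => by rw [abs_sub_comm]; exact abs_quadForm_avgHess_sub_left_le hf hLip z z' w) hc ha
  have H'K : (a • K - H').PosSemidef := smul_sub_posSemidef_of_abs_quadForm_le hμ sH' sK μK
    (fun w => by rw [abs_sub_comm]; exact abs_quadForm_avgHess_sub_right_le hf hLip z z' w) hc ha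
  have paK : (a • K).PosDef := pK.smul ha0
  have DK : (D - a • K).PosSemidef := by
    refine posSemidef_sub_trans ?_ h.posSemidef
    rw [sq, mul_smul, ← smul_sub]
    exact KH.smul ha0.le
  have QK := bfgs_sub_posSemidef paK DK v
  have tQ := trace_inv_mul_bfgs_le_self paK DK v
  set Q := bfgs D (a • K) v
  have QH' : (Q - H').PosSemidef := posSemidef_sub_trans H'K QK
  have pD := (posDef_of_posSemidef_sub paK DK).posSemidef
  have pQ := (posDef_of_posSemidef_sub paK QK).posSemidef
  -- The reference matrix moves from H to aK (H ⪯ aK, no loss) and then to H' (aK ⪯ a²H', loss a²);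
  -- the other a² is the scale of D.
  have t₁ : (H'⁻¹ * Q).trace ≤ a ^ 2 * ((a • K)⁻¹ * Q).trace := by
    refine trace_inv_mul_le (by positivity) paK ?_ pQ
    rw [sq, mul_smul, ← smul_sub]
    exact KH'.smul ha0.le
  have t₂ : ((a • K)⁻¹ * D).trace ≤ (H⁻¹ * D).trace := by
    have := trace_inv_mul_le (H := a • K) (K := H) (A := D) one_pos pH (by rwa [one_smul]) pD
    rwa [one_mul] at this
  have t₃ := trace_inv_mul_bfgs_greedy_le hμ hL μH' (smul_one_sub_hess_posSemidef hf hsmooth z')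
    QH' hu
  have hq : 0 ≤ 1 - μ / (d * L) := by
    have hd : (1 : ℝ) ≤ d := by exact_mod_cast NeZero.one_le
    rw [sub_nonneg, div_le_one (by positivity)]
    nlinarith
  have t₄ : (H'⁻¹ * Q).trace ≤ a ^ 4 * (d + e) :=
    calc _ ≤ a ^ 2 * (a ^ 2 * (d + e)) :=
          t₁.trans (by gcongr; exact (tQ.trans t₂).trans h.trace_le)
      _ = _ := by ring
  refine ⟨?_, ?_, hz'⟩
  · rw [one_smul]
    exact bfgs_sub_posSemidef pH' QH' u
  · have t₅ := mul_le_mul_of_nonneg_left (sub_le_sub_right t₄ (d : ℝ)) hq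
    linarith

theorem idx_eq [NeZero n] {k j : ℕ} (hj : j < n) : idx n (k * n + j + 1) = ⟨j, hj⟩ := by
  apply Fin.ext
  simp only [idx, Nat.add_sub_cancel, Nat.mul_add_mod_self_right, Nat.mod_eq_of_lt hj]

theorem omega_of_lt (α : ℕ → ℝ) {k j : ℕ} (hj : j + 1 < n) :
    omega n α (k * n + j + 1) = 1 := by
  rw [omega, if_neg]
  rw [add_assoc, Nat.mul_add_mod_self_right, Nat.mod_eq_of_lt hj]
  omega

theorem omega_of_eq [NeZero n] (α : ℕ → ℝ) {k j : ℕ} (hj : j + 1 = n) :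
    omega n α (k * n + j + 1) = (1 + α (k + 1)) ^ 2 := by
  have h : k * n + j + 1 = (k + 1) * n := by rw [add_assoc, hj]; ring
  have hn : (n : ℝ) ≠ 0 := by exact_mod_cast NeZero.ne n
  rw [omega, h, Nat.mul_mod_left, if_pos rfl, Nat.cast_mul, mul_div_cancel_right₀ _ hn,
    Nat.ceil_natCast]

/-- The argument is k plus a number in (-1, 0], so all n steps of an epoch use the same α_k; at k =
0 the natural ceiling of a nonpositive number is 0. -/
theorem ceil_epoch {k j : ℕ} (hj : j < n) :
    ⌈((k * n + j + 1 : ℕ) : ℝ) / n - 1⌉₊ = k := by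
  have hn : (0 : ℝ) < n := by exact_mod_cast (Nat.zero_le j).trans_lt hj
  have hj' : (j : ℝ) + 1 ≤ n := by exact_mod_cast hj
  have h : ((k * n + j + 1 : ℕ) : ℝ) / n - 1 = k + ((j + 1) / n - 1) := by
    push_cast
    field_simp
    ring
  have h₁ : ((j : ℝ) + 1) / n ≤ 1 := (div_le_one hn).2 hj'
  have h₀ : 0 < ((j : ℝ) + 1) / n := by positivity
  rw [h]
  apply le_antisymm
  · rw [Nat.ceil_le]
    linarith
  · cases k with
    | zero => exact Nat.zero_le _
    | succ m =>
      rw [Nat.succ_le_iff, Nat.lt_ceil]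
      push_cast
      linarith

/-- The state after `j` steps of epoch `k`. -/
def EpochState [NeZero n] (f : Fin n → Vec d → ℝ) (xstar : Vec d) (α e η : ℕ → ℝ)
    (z : Fin n → Vec d) (D : Fin n → Mat d) (k j : ℕ) : Prop :=
  (∀ i : Fin n, i.1 < j → Controlled (f i) xstar 1 (e (k + 1)) (η (k + 1)) (z i) (D i)) ∧
    ∀ i : Fin n, j ≤ i.1 → Controlled (f i) xstar ((1 + α k) ^ 2) (e k) (η k) (z i) (D i)

/-- The scalar sequences are abstract here: e bounds the matrix errors and η the distances.
Mid-epoch, both epoch-k and epoch-(k + 1) tuples occur, so b k dominates e k and e (k + 1), and one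
inequality covers every residual. -/
theorem norm_sub_le_of_isRun [NeZero n] [NeZero d] {f : Fin n → Vec d → ℝ} {xstar : Vec d}
    {α e b η : ℕ → ℝ} {I₀ : Fin n → Mat d} {x : ℕ → Vec d} {z : ℕ → Fin n → Vec d}
    {D : ℕ → Fin n → Mat d} {Q : ℕ → Mat d} {u : ℕ → Fin d → ℝ}
    (hμ : 0 < μ) (hμL : μ ≤ L) (hLt : 0 ≤ Lt) (hf : ∀ i, ContDiff ℝ 2 (f i))
    (hconv : ∀ i, StronglyConvex μ (f i)) (hsmooth : ∀ i, Smooth L (f i))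
    (hLip : ∀ i, LipschitzHessian Lt (f i)) (hgrad : ∑ i, gradient (f i) xstar = 0)
    (hrun : IsRun f α I₀ x z D Q u)
    (hI₀ : ∀ i, (I₀ i - hess (f i) (x 0)).PosSemidef) (hx₀ : ‖x 0 - xstar‖ ≤ η 0)
    (hσ : ∀ i, sigma (I₀ i) (hess (f i) (x 0)) ≤ e 0)
    (he0 : ∀ k, 0 ≤ e k) (heb : ∀ k, e k ≤ b k) (heb' : ∀ k, e (k + 1) ≤ b k)
    (hη0 : ∀ k, 0 ≤ η k) (hη : ∀ k, η (k + 1) ≤ η k)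
    (hα : ∀ k, Lt * η k / μ ≤ α k)
    (he_succ : ∀ k, (1 - μ / (d * L)) * ((1 + α k) ^ 4 * (d + e k) - d) ≤ e (k + 1))
    (hη_succ : ∀ k, (L * ((1 + α k) ^ 2 * (d + b k) - d) + Lt * η k) * η k ≤ μ * η (k + 1))
    (t : ℕ) : ‖x (t + 1) - xstar‖ ≤ η (t / n + 1) := by
  have hL : 0 < L := hμ.trans_le hμL
  have hα0 : ∀ k, 0 ≤ α k := fun k =>
    (hα k).trans' (div_nonneg (mul_nonneg hLt (hη0 k)) hμ.le)
  have hd : (0 : ℝ) ≤ d := Nat.cast_nonneg d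
  have hα1 : ∀ k, 1 ≤ (1 + α k) ^ 2 := fun k => one_le_pow₀ (by linarith [hα0 k])
  have hx : ∀ t k j, EpochState f xstar α e η (z t) (D t) k j →
      ‖x (t + 1) - xstar‖ ≤ η (k + 1) := by
    rintro t k j ⟨h₁, h₂⟩
    rw [hrun.x_succ]
    have hall : ∀ i, ∃ s e' r, Controlled (f i) xstar s e' r (z t i) (D t i) ∧ 1 ≤ s ∧
        (L * (s * (d + e') - d) + Lt * r) * r ≤ μ * η (k + 1) := fun i => by
      rcases lt_or_ge i.1 j with hij | hij
      · refine ⟨_, _, _, h₁ i hij, le_rfl, (hη_succ k).trans' ?_⟩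
        have := hη k
        have := hη0 (k + 1)
        have h3 : (1 : ℝ) * (d + e (k + 1)) ≤ (1 + α k) ^ 2 * (d + b k) :=
          mul_le_mul (hα1 k) (by linarith [heb' k]) (by linarith [he0 (k + 1)]) (by positivity)
        have h4 : 0 ≤ (1 + α k) ^ 2 * (d + b k) - d := by
          linarith [he0 (k + 1)]
        have := hη0 k
        gcongr
      · refine ⟨_, _, _, h₂ i hij, hα1 k, (hη_succ k).trans' ?_⟩
        have := hη0 k
        gcongr
        exact heb k
    choose s e' r hC hs hc using hall
    exact le_of_mul_le_mul_left
      (norm_newton_step_sub_le hμ hL hLt hf hconv hsmooth hLip hgrad hC hs hc) hμ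
  have hstate : ∀ t, ∃ k j, t = k * n + j ∧ j < n ∧
      EpochState f xstar α e η (z t) (D t) k j := by
    intro t
    induction t with
    | zero =>
      refine ⟨0, 0, by simp, NeZero.pos n, fun i hi => absurd hi (Nat.not_lt_zero _),
        fun i _ => ?_⟩
      have hH := hess_posDef hμ (hf i) (hconv i) (x 0)
      have h₀ : Controlled (f i) xstar 1 (e 0) (η 0) (x 0) (I₀ i) := by
        refine ⟨by rw [one_smul]; exact hI₀ i, ?_, hx₀⟩
        have h := hσ i
        have hT : ((hess (f i) (x 0))⁻¹)ᵀ = (hess (f i) (x 0))⁻¹ := by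
          simpa [IsHermitian, conjTranspose_eq_transpose_of_trivial] using hH.inv.1
        rw [sigma, hT, trace_inv_mul_sub hH] at h
        linarith
      have h₁ := h₀.smul (sq_nonneg (1 + α 0))
      rwa [mul_one, ← hrun.D_zero, ← hrun.z_zero i] at h₁
    | succ t ih =>
      obtain ⟨k, j, rfl, hj, hS⟩ := ih
      have hxt := hx _ k j hS
      obtain ⟨h₁, h₂⟩ := hS
      have hidx : idx n (k * n + j + 1) = ⟨j, hj⟩ := idx_eq hj
      set t := k * n + j with ht
      set w := omega n α (t + 1) with hw
      have hw0 : 0 ≤ w := by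
        rw [hw, omega]
        split_ifs <;> positivity
      have hnew : Controlled (f ⟨j, hj⟩) xstar (w * 1) (e (k + 1)) (η (k + 1))
          (z (t + 1) ⟨j, hj⟩) (D (t + 1) ⟨j, hj⟩) := by
        have hz := hrun.z_succ t
        have hQ := hrun.Q_succ t
        have hu := hrun.u_succ t
        have hD := hrun.D_succ t
        rw [hidx] at hz hQ hu hD
        rw [ht, ceil_epoch hj, ← ht] at hQ
        rw [hD]
        refine Controlled.smul ?_ hw0
        rw [hQ] at hu ⊢
        have hold := h₂ ⟨j, hj⟩ le_rfl
        rw [← hz] at hxt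
        -- The 2 cancels the 1/2 from averaging, so α_k ≥ Lt η_k/μ suffices.
        have hdist : ‖z (t + 1) ⟨j, hj⟩ - z t ⟨j, hj⟩‖ ≤ 2 * η k := by
          have e₁ : z (t + 1) ⟨j, hj⟩ - z t ⟨j, hj⟩ =
            (z (t + 1) ⟨j, hj⟩ - xstar) - (z t ⟨j, hj⟩ - xstar) := by abel
          rw [e₁]
          refine (norm_sub_le _ _).trans ?_
          linarith [hold.dist_le, hη k]
        have ha : 1 + Lt * ‖z (t + 1) ⟨j, hj⟩ - z t ⟨j, hj⟩‖ / 2 / μ ≤ 1 + α k := by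
          have : Lt * ‖z (t + 1) ⟨j, hj⟩ - z t ⟨j, hj⟩‖ / 2 / μ ≤ Lt * (2 * η k) / 2 / μ := by
            gcongr
          have e₂ : Lt * (2 * η k) / 2 / μ = Lt * η k / μ := by ring
          linarith [hα k]
        have hres := hold.bfgs_update hμ hL hLt hμL (hf _) (hconv _) (hsmooth _) (hLip _)
          hxt ha hu
        exact ⟨hres.posSemidef, hres.trace_le.trans (by gcongr; exact he_succ k),
          hres.dist_le⟩
      have hother : ∀ i : Fin n, i.1 ≠ j → ∀ {s e' r : ℝ},
          Controlled (f i) xstar s e' r (z t i) (D t i) →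
          Controlled (f i) xstar (w * s) e' r (z (t + 1) i) (D (t + 1) i) := by
        intro i hi s e' r hC
        have hne : i ≠ idx n (t + 1) := by
          rw [hidx]
          exact fun h => hi (congrArg Fin.val h)
        rw [hrun.z_succ_of_ne t i hne, hrun.D_succ_of_ne t i hne]
        exact hC.smul hw0
      rcases Nat.lt_or_eq_of_le (Nat.succ_le_of_lt hj) with hj' | hj'
      · have hw1 : w = 1 := omega_of_lt α hj'
        rw [hw1] at hnew hother
        refine ⟨k, j + 1, by rw [ht, add_assoc], hj', fun i hi => ?_, fun i hi => ?_⟩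
        · rcases Nat.lt_succ_iff_lt_or_eq.1 hi with hi | hi
          · simpa using hother i hi.ne (h₁ i hi)
          · obtain rfl : i = ⟨j, hj⟩ := Fin.ext hi
            simpa using hnew
        · simpa using hother i (by omega) (h₂ i (by omega))
      -- The epoch's last step rescales all tuples, giving the state at the start of epoch k + 1.
      · have hw1 : w = (1 + α (k + 1)) ^ 2 := omega_of_eq α hj'
        rw [hw1] at hnew hother
        refine ⟨k + 1, 0, ?_, NeZero.pos n, fun i hi => absurd hi (Nat.not_lt_zero _),
          fun i _ => ?_⟩
        · rw [ht, add_assoc, ← Nat.succ_eq_add_one, hj']; ring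
        · rcases eq_or_ne i.1 j with hi | hi
          · obtain rfl : i = ⟨j, hj⟩ := Fin.ext hi
            simpa using hnew
          · simpa using hother i hi (h₁ i (by omega))
  obtain ⟨k, j, rfl, hj, hS⟩ := hstate t
  have hk : (k * n + j) / n = k := by
    rw [mul_comm, Nat.mul_add_div (NeZero.pos n), Nat.div_eq_of_lt hj, add_zero]
  rw [hk]
  exact hx _ k j hS

end Run

/-! ### Scalar estimates and the superlinear radius. -/

section Rates

theorem one_add_pow_four_le {a : ℝ} (h0 : 0 ≤ a) (h1 : a ≤ 1) : (1 + a) ^ 4 ≤ 1 + 15 * a := by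
  have h2 : a ^ 2 ≤ a := by nlinarith
  have h3 : a ^ 3 ≤ a := by nlinarith
  have h4 : a ^ 4 ≤ a := by nlinarith
  nlinarith

theorem one_add_sq_le {a : ℝ} (h0 : 0 ≤ a) (h1 : a ≤ 1) : (1 + a) ^ 2 ≤ 1 + 3 * a := by
  nlinarith

/-- The radius `ε ρ^k q^(k(k-1)/2)` of the iterates in epoch `k`. -/
noncomputable def radius (ε ρ q : ℝ) (k : ℕ) : ℝ :=
  ε * ∏ i ∈ Finset.range k, (ρ * q ^ i)

variable {ε ρ q : ℝ}

theorem radius_zero : radius ε ρ q 0 = ε := by simp [radius]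

theorem radius_succ (k : ℕ) : radius ε ρ q (k + 1) = ρ * q ^ k * radius ε ρ q k := by
  rw [radius, radius, Finset.prod_range_succ]
  ring

theorem radius_nonneg (hε : 0 ≤ ε) (hρ : 0 ≤ ρ) (hq : 0 ≤ q) (k : ℕ) :
    0 ≤ radius ε ρ q k :=
  mul_nonneg hε (Finset.prod_nonneg fun _ _ => by positivity)

theorem radius_le_mul_pow (hε : 0 ≤ ε) (hρ : 0 ≤ ρ) (hq : 0 ≤ q) (hq1 : q ≤ 1) (k : ℕ) :
    radius ε ρ q k ≤ ε * ρ ^ k := by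
  refine mul_le_mul_of_nonneg_left ?_ hε
  calc _ ≤ ∏ _i ∈ Finset.range k, ρ := Finset.prod_le_prod (fun _ _ => by positivity)
        fun i _ => mul_le_of_le_one_right hρ (pow_le_one₀ hq hq1)
    _ = ρ ^ k := by simp

/-- Each factor ρq^i is at most q^{i+1}, and 1 + ⋯ + (k + 1) is the exponent. -/
theorem radius_succ_le (hε : 0 ≤ ε) (hρ : 0 ≤ ρ) (hρq : ρ ≤ q) (k : ℕ) :
    radius ε ρ q (k + 1) ≤ ε * q ^ ((k + 2) * (k + 1) / 2) := by
  have hq : 0 ≤ q := hρ.trans hρq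
  induction k with
  | zero => simpa [radius] using mul_le_mul_of_nonneg_left hρq hε
  | succ k ih =>
    have h : (k + 1 + 2) * (k + 1 + 1) / 2 = (k + 2) * (k + 1) / 2 + (k + 2) := by
      rw [← Nat.add_mul_div_right _ _ two_pos]
      congr 1
      ring
    have hr := radius_nonneg hε hρ hq (k + 1)
    rw [radius_succ, h]
    calc _ ≤ q * q ^ (k + 1) * (ε * q ^ ((k + 2) * (k + 1) / 2)) := by gcongr
      _ = _ := by ring

end Rates

/-- The right side is (Lt/μ)√(L/μ), so the prescribed α_k dominates the required Lt η_k/μ. -/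
theorem div_le_alpha_coefficient {μ L Lt : ℝ} (hμ : 0 < μ) (hμL : μ ≤ L) (hLt : 0 ≤ Lt) :
    Lt / μ ≤ Lt / μ ^ (3 / 2 : ℝ) * √L := by
  have h : μ ^ (3 / 2 : ℝ) = μ * √μ := by
    rw [Real.sqrt_eq_rpow, ← Real.rpow_one_add' hμ.le (by norm_num)]
    norm_num
  have hs : 0 < √μ := Real.sqrt_pos.2 hμ
  rw [h, div_mul_eq_mul_div, div_le_div_iff₀ hμ (by positivity)]
  have : √μ ≤ √L := Real.sqrt_le_sqrt hμL
  calc Lt * (μ * √μ) ≤ Lt * (μ * √L) := by gcongr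
    _ = _ := by ring

end SLIQN

/-! ### Main theorem: choice of the constants. -/

theorem theorem1 {n d : ℕ} [NeZero n] [NeZero d] (μ L Lt : ℝ) (hμ : 0 < μ)
    (f : Fin n → SLIQN.Vec d → ℝ)
    (hf : ∀ i, ContDiff ℝ 2 (f i))
    (hconv : ∀ i, SLIQN.StronglyConvex μ (f i))
    (hsmooth : ∀ i, SLIQN.Smooth L (f i))
    (hLip : ∀ i, SLIQN.LipschitzHessian Lt (f i))
    (xstar : SLIQN.Vec d)
    (hmin : ∀ y, (1 / (n : ℝ)) * ∑ i, f i xstar ≤ (1 / (n : ℝ)) * ∑ i, f i y)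
    (ρ : ℝ) (hρ0 : 0 < ρ) (hρ1 : ρ < 1 - μ / (d * L)) :
    ∃ ε : ℝ, 0 < ε ∧ ∃ σ₀ : ℝ, 0 < σ₀ ∧
      ∀ (I₀ : Fin n → SLIQN.Mat d) (x : ℕ → SLIQN.Vec d) (z : ℕ → Fin n → SLIQN.Vec d)
        (D : ℕ → Fin n → SLIQN.Mat d) (Q : ℕ → SLIQN.Mat d) (u : ℕ → Fin d → ℝ),
        SLIQN.IsRun f (SLIQN.alpha μ L Lt ε ρ) I₀ x z D Q u →
        (∀ i, (I₀ i - SLIQN.hess (f i) (x 0)).PosSemidef) →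
        ‖x 0 - xstar‖ ≤ ε →
        (∀ i, SLIQN.sigma (I₀ i) (SLIQN.hess (f i) (x 0)) ≤ σ₀) →
        ∃ ζ : ℕ → ℝ,
          (∀ t : ℕ, 1 ≤ t → ‖x t - xstar‖ ≤ ζ ((t - 1) / n)) ∧
          ∀ k : ℕ, ζ k ≤ ε * (1 - μ / (d * L)) ^ ((k + 2) * (k + 1) / 2) := by
  have hμL : μ ≤ L := SLIQN.modulus_le_of_stronglyConvex_of_smooth (hconv 0) (hsmooth 0)
  have hLt : 0 ≤ Lt := SLIQN.lipschitzHessian_const_nonneg (hLip 0)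
  have hL : 0 < L := hμ.trans_le hμL
  have hd : (0 : ℝ) < d := by exact_mod_cast NeZero.pos d
  have hgrad := SLIQN.sum_gradient_eq_zero hf hmin
  have hγ₀ := SLIQN.div_le_alpha_coefficient hμ hμL hLt
  set γ := Lt / μ ^ (3 / 2 : ℝ) * √L with hγdef
  have hγ : 0 ≤ γ := (div_nonneg hLt hμ.le).trans hγ₀
  have hq1 : 1 - μ / (d * L) ≤ 1 := by
    rw [sub_le_self_iff]
    positivity
  set q := 1 - μ / (d * L) with hq
  have hq0 : 0 < q := hρ0.trans hρ1
  have hqρ : 0 < q - ρ := sub_pos.2 hρ1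
  -- With this C, -εCρ^k is a particular solution of e_{k+1} = q e_k + 15(d + 1)γqερ^k, the
  -- linearized error recursion.
  set C := 15 * (d + 1) * γ * q / (q - ρ) with hC
  have hC0 : 0 ≤ C := by positivity
  have hCq : C * (q - ρ) = 15 * (d + 1) * γ * q := div_mul_cancel₀ _ hqρ.ne'
  set X := L * (1 + C + 3 * γ * (d + 1)) + Lt with hX
  have hX0 : 0 ≤ X := by positivity
  -- The conditions give, in turn, α_k ≤ 1, matrix errors at most 1, and a Newton factor at most
  -- ρq^k.
  obtain ⟨ε, hε, hεγ, hεC, hεX⟩ :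
      ∃ ε : ℝ, 0 < ε ∧ γ * ε ≤ 1 ∧ ε * (1 + C) ≤ 1 ∧ ε * X ≤ μ * ρ := by
    have hpos : 0 < γ + (1 + C) + X / (μ * ρ) := by positivity
    have hXμ : 0 ≤ X / (μ * ρ) := by positivity
    refine ⟨1 / (γ + (1 + C) + X / (μ * ρ)), by positivity, ?_, ?_, ?_⟩
    · rw [mul_one_div, div_le_one hpos]
      linarith
    · rw [one_div_mul_eq_div, div_le_one hpos]
      linarith
    · rw [one_div_mul_eq_div, div_le_iff₀ hpos, ← div_le_iff₀' (by positivity)]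
      linarith
  refine ⟨ε, hε, ε, hε, fun I₀ x z D Q u hrun hI₀ hx₀ hσ => ?_⟩
  have hαval : ∀ k, SLIQN.alpha μ L Lt ε ρ k = γ * ε * ρ ^ k := fun k => rfl
  have hρq : ∀ k : ℕ, ρ ^ k ≤ q ^ k := fun k => pow_le_pow_left₀ hρ0.le hρ1.le k
  have hqk : ∀ k : ℕ, q ^ k ≤ 1 := fun k => pow_le_one₀ hq0.le hq1
  have hα0 : ∀ k, 0 ≤ SLIQN.alpha μ L Lt ε ρ k := fun k => by rw [hαval]; positivity
  have hα1 : ∀ k, SLIQN.alpha μ L Lt ε ρ k ≤ 1 := fun k => by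
    rw [hαval]
    exact mul_le_one₀ hεγ (by positivity) ((hρq k).trans (hqk k))
  have hb1 : ∀ k : ℕ, ε * (1 + C) * q ^ k ≤ 1 := fun k =>
    mul_le_one₀ hεC (by positivity) (hqk k)
  have heb : ∀ k : ℕ, ε * ((1 + C) * q ^ k - C * ρ ^ k) ≤ ε * (1 + C) * q ^ k := fun k => by
    have : 0 ≤ ε * (C * ρ ^ k) := by positivity
    linarith
  have he0 : ∀ k : ℕ, 0 ≤ ε * ((1 + C) * q ^ k - C * ρ ^ k) := fun k => by
    have h₁ : C * ρ ^ k ≤ C * q ^ k := by gcongr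
    have h₂ : 0 < q ^ k := by positivity
    exact mul_nonneg hε.le (by linarith)
  have hη0 := SLIQN.radius_nonneg hε.le hρ0.le hq0.le
  have hηρ := SLIQN.radius_le_mul_pow hε.le hρ0.le hq0.le hq1
  refine ⟨fun k => SLIQN.radius ε ρ q (k + 1), fun t ht => ?_,
    SLIQN.radius_succ_le hε.le hρ0.le hρ1.le⟩
  obtain ⟨t, rfl⟩ := Nat.exists_eq_add_of_le' ht
  -- This e solves the recursion with e 0 = ε, which is why σ₀ = ε works; it need not be monotone,
  -- whereas b is.
  refine SLIQN.norm_sub_le_of_isRun (b := fun k => ε * (1 + C) * q ^ k)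
    (e := fun k => ε * ((1 + C) * q ^ k - C * ρ ^ k)) hμ hμL hLt hf hconv hsmooth hLip hgrad
    hrun hI₀ (hx₀.trans_eq SLIQN.radius_zero.symm) (fun i => (hσ i).trans_eq (by ring))
    he0 heb (fun k => (heb (k + 1)).trans ?_) hη0 (fun k => ?_) (fun k => ?_) (fun k => ?_)
    (fun k => ?_) t
  · rw [pow_succ]
    gcongr
    exact mul_le_of_le_one_right (by positivity) hq1
  · rw [SLIQN.radius_succ]
    exact mul_le_of_le_one_left (hη0 k)
      (mul_le_one₀ (hρ1.le.trans hq1) (by positivity) (hqk k))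
  · rw [hαval]
    calc Lt * SLIQN.radius ε ρ q k / μ = Lt / μ * SLIQN.radius ε ρ q k := by ring
      _ ≤ γ * (ε * ρ ^ k) := by
        have := hη0 k
        gcongr
        exact hηρ k
      _ = _ := by ring
  · have h₁ := SLIQN.one_add_pow_four_le (hα0 k) (hα1 k)
    have he := he0 k
    have he1 := (heb k).trans (hb1 k)
    have hk := hα0 k
    rw [← hq]
    calc _ ≤ q * ((1 + 15 * SLIQN.alpha μ L Lt ε ρ k) *
            (d + ε * ((1 + C) * q ^ k - C * ρ ^ k)) - d) := by gcongr
      _ = q * (ε * ((1 + C) * q ^ k - C * ρ ^ k) + 15 * SLIQN.alpha μ L Lt ε ρ k *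
            (d + ε * ((1 + C) * q ^ k - C * ρ ^ k))) := by ring
      _ ≤ q * (ε * ((1 + C) * q ^ k - C * ρ ^ k) + 15 * SLIQN.alpha μ L Lt ε ρ k *
            (d + 1)) := by gcongr
      _ = ε * ((1 + C) * q ^ (k + 1) - C * q * ρ ^ k
            + (15 * (d + 1) * γ * q) * ρ ^ k) := by rw [hαval]; ring
      _ = _ := by rw [← hCq]; ring
  · have h₁ := SLIQN.one_add_sq_le (hα0 k) (hα1 k)
    have hk := hα0 k
    have hr := hη0 k
    have hηq : SLIQN.radius ε ρ q k ≤ ε * q ^ k := (hηρ k).trans (by gcongr)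
    rw [SLIQN.radius_succ, ← mul_assoc]
    refine mul_le_mul_of_nonneg_right ?_ hr
    calc _ ≤ L * ((1 + 3 * SLIQN.alpha μ L Lt ε ρ k) * (d + ε * (1 + C) * q ^ k) - d) +
            Lt * (ε * q ^ k) := by gcongr
      _ = L * (ε * (1 + C) * q ^ k + 3 * SLIQN.alpha μ L Lt ε ρ k *
            (d + ε * (1 + C) * q ^ k)) + Lt * (ε * q ^ k) := by ring
      _ ≤ L * (ε * (1 + C) * q ^ k + 3 * (γ * ε * q ^ k) * (d + 1)) + Lt * (ε * q ^ k) := by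
        rw [hαval]
        have := hb1 k
        have := hρq k
        gcongr
      _ = ε * X * q ^ k := by rw [hX]; ring
      _ ≤ μ * ρ * q ^ k := by gcongr
      _ = _ := by ring
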